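/- A length function on a group $G$ is a map $l:G\to\mathbb{R}_{\ge 0}$ with $l(e)=0$, $l(g^{-1})=l(g)$ and $l(gh)\le l(g)+l(h)$ for all $g,h\in G$. A function $f:\mathbb{N}\to\mathbb{R}_{\ge0}$ is subexponential if $\lim_{n\to\infty} f(n)^{1/n}=1$. A countable group $G$ has property SD (subexponential decay) with respect to a length function $l$, with decay function $f$, if $f$ is subexponential and for every $D\in\mathbb{N}$ and every $x\in\mathbb{C}[G]$ supported on $\{g\in G: l(g)\le D\}$ one has $\|x\|\le f(D)\,\|x\|_2$. Here $\|x\|$ is the norm of $x$ acting on $\ell^2(G)$ through the left regular representation, and $\|x\|_2=\big(\sum_{g}|x_g|^2\big)^{1/2}$. **Lemma.** Let $G$ and $H$ be countable groups that have property SD with respect to length functions $l_G$ and $l_H$, with decay functions $f_G$ and $f_H$ respectively. Put $$f(x)=(2x+1)^{7/2}\max(f_G(x),f_H(x)),\qquad x\in\mathbb{N}.$$ 1. The free product $G*H$ has property SD, with decay function $f$, with respect to some length function on $G*H$. 2. If $l_G(g)\ge 1$ for all $g\in G\setminus\{e\}$ and $l_H(h)\ge 1$ for all $h\in H\setminus\{e\}$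 (for instance, if both length functions are integer-valued and vanish only at the identity), then $G*H$ has property SD, with decay function $f$, with respect to the natural free-product length $$l_{G*H}(s_1s_2\cdots s_n)=\sum_{i=1}^n l(s_i),\qquad s_1s_2\cdots s_n \text{ a reduced word},$$ that is, the letters $s_i$ are non-identity elements taken alternately from $G$ and $H$, and $l(s_i)$ means $l_G(s_i)$ or $l_H(s_i)$ according to the factor containing $s_i$. -/

import Mathlib

open scoped NNReal

namespace SubexpDecay

universe u v

section Analysis

variable {G : Type u} [Group G]

/-- A length function on a group. -/
structure IsLength (l : G → ℝ≥0) : Prop where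
  map_one : l 1 = 0
  map_inv : ∀ g, l g⁻¹ = l g
  map_mul_le : ∀ g h, l (g * h) ≤ l g + l h

/-- A function `f : ℕ → ℝ≥0` is subexponential if `f n ^ (1 / n) → 1`. -/
def IsSubexp (f : ℕ → ℝ≥0) : Prop :=
  Filter.Tendsto (fun n : ℕ => f n ^ (1 / (n : ℝ))) Filter.atTop (nhds 1)

variable (G) in
/-- The Hilbert space `ℓ²(G)`. -/
abbrev Ell2 : Type u := lp (fun _ : G => ℂ) 2

theorem memlp_translate (g : G) (ξ : Ell2 G) :
    Memℓp (fun h : G => (ξ : G → ℂ) (g⁻¹ * h)) 2 := by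
  have h2 : 0 < (2 : ENNReal).toReal := by norm_num
  exact (memℓp_gen_iff h2).2
    ((Equiv.summable_iff (Equiv.mulLeft g⁻¹)).2 ((memℓp_gen_iff h2).1 (lp.memℓp ξ)))

/-- Left translation by `g` on `ℓ²(G)`: `(λ(g) ξ)(h) = ξ(g⁻¹ h)`. -/
noncomputable def translate (g : G) : Ell2 G →ₗᵢ[ℂ] Ell2 G where
  toFun ξ := ⟨fun h => (ξ : G → ℂ) (g⁻¹ * h), memlp_translate g ξ⟩
  map_add' _ _ := rfl
  map_smul' _ _ := rfl
  norm_map' ξ := by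
    have h2 : 0 < (2 : ENNReal).toReal := by norm_num
    rw [lp.norm_eq_tsum_rpow h2, lp.norm_eq_tsum_rpow h2]
    congr 1
    exact (Equiv.mulLeft g⁻¹).tsum_eq (fun h => ‖(ξ : G → ℂ) h‖ ^ (2 : ENNReal).toReal)

@[simp] theorem translate_apply (g : G) (ξ : Ell2 G) (h : G) :
    (translate g ξ : G → ℂ) h = (ξ : G → ℂ) (g⁻¹ * h) := rfl

/-- The left regular representation `g ↦ λ(g)` by bounded operators on `ℓ²(G)`. -/
noncomputable def leftRegular : G →* (Ell2 G →L[ℂ] Ell2 G) where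
  toFun g := (translate g).toContinuousLinearMap
  map_one' := by
    ext ξ h
    simp
  map_mul' g₁ g₂ := by
    ext ξ h
    simp [mul_assoc]

/-- The left regular representation `ℂ[G] → B(ℓ²(G))`, `∑ x_g g ↦ ∑ x_g λ(g)`. -/
noncomputable def regularRep : MonoidAlgebra ℂ G →ₐ[ℂ] (Ell2 G →L[ℂ] Ell2 G) :=
  MonoidAlgebra.lift ℂ (Ell2 G →L[ℂ] Ell2 G) G leftRegular

/-- The reduced operator norm `‖x‖` of an element `x` of `ℂ[G]`. -/
noncomputable def opNorm (x : MonoidAlgebra ℂ G) : ℝ := ‖regularRep x‖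

/-- The norm `‖x‖₂ = (∑ |x_g|²)^{1/2}` of an element `x` of `ℂ[G]`. -/
noncomputable def twoNorm (x : MonoidAlgebra ℂ G) : ℝ :=
  Real.sqrt (∑ g ∈ x.coeff.support, ‖x.coeff g‖ ^ 2)

/-- The countable group `G` has subexponential decay with respect to the length function `l`,
with decay function `f`. -/
structure HasSD (l : G → ℝ≥0) (f : ℕ → ℝ≥0) : Prop where
  countable : Countable G
  isLength : IsLength l
  isSubexp : IsSubexp f
  decay : ∀ (D : ℕ) (x : MonoidAlgebra ℂ G),
    (∀ g ∈ x.coeff.support, l g ≤ D) → opNorm x ≤ f D * twoNorm x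

end Analysis

section FreeProduct

/-- The two factors as a family indexed by `Bool`, in a common universe. -/
abbrev Fam (G : Type u) (H : Type v) (b : Bool) : Type (max u v) :=
  Bool.rec (ULift.{u} H) (ULift.{v} G) b

/-- A letter as an element of the family. -/
def letter {G : Type u} {H : Type v} : G ⊕ H → Σ b, Fam G H b :=
  Sum.elim (fun g => ⟨true, ULift.up g⟩) (fun h => ⟨false, ULift.up h⟩)

theorem letter_injective {G : Type u} {H : Type v} : Function.Injective (letter : G ⊕ H → Σ b, Fam G H b) := by
  rintro (g | h) (g' | h') e
  · simpa [letter] using e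
  · simp [letter] at e
  · simp [letter] at e
  · simpa [letter] using e

open Monoid.Coprod

variable {G : Type u} {H : Type v} [Group G] [Group H]

/-- A word in the letters of `G` and `H` is reduced if no letter is an identity element and
adjacent letters come from different factors. -/
def IsReduced (w : List (G ⊕ H)) : Prop :=
  (∀ s ∈ w, s ≠ Sum.inl 1 ∧ s ≠ Sum.inr 1) ∧ w.IsChain (fun s t => s.isLeft ≠ t.isLeft)

/-- The element of the free product `G * H` that a word represents. -/
def wordProd (w : List (G ⊕ H)) : Monoid.Coprod G H :=
  (w.map (Sum.elim (fun g => inl g) (fun h => inr h))).prod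

theorem exists_reduced (x : Monoid.Coprod G H) :
    ∃ w : List (G ⊕ H), IsReduced w ∧ wordProd w = x := by
  induction x using Monoid.Coprod.induction_on' with
  | one => exact ⟨[], ⟨by simp, by simp⟩, rfl⟩
  | inl_mul g x ih =>
    obtain ⟨w, ⟨hw1, hw2⟩, rfl⟩ := ih
    by_cases hg : g = 1
    · exact ⟨w, ⟨hw1, hw2⟩, by simp [hg]⟩
    rcases w with _ | ⟨a | b, w⟩
    · exact ⟨[Sum.inl g], ⟨by simpa using hg, by simp⟩, by simp [wordProd]⟩
    · by_cases hga : g * a = 1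
      · refine ⟨w, ⟨fun s hs => hw1 s (by simp [hs]), hw2.tail⟩, ?_⟩
        simp [wordProd, ← mul_assoc, ← map_mul, hga]
      · refine ⟨Sum.inl (g * a) :: w, ⟨?_, ?_⟩, by simp [wordProd, mul_assoc]⟩
        · intro s hs
          rcases List.mem_cons.1 hs with rfl | hs
          · simpa using hga
          · exact hw1 s (by simp [hs])
        · rcases w with _ | ⟨c, w⟩
          · simp
          · simpa using hw2
    · refine ⟨Sum.inl g :: Sum.inr b :: w, ⟨?_, ?_⟩, by simp [wordProd]⟩
      · intro s hs
        rcases List.mem_cons.1 hs with rfl | hs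
        · simpa using hg
        · exact hw1 s hs
      · simpa using hw2
  | inr_mul g x ih =>
    obtain ⟨w, ⟨hw1, hw2⟩, rfl⟩ := ih
    by_cases hg : g = 1
    · exact ⟨w, ⟨hw1, hw2⟩, by simp [hg]⟩
    rcases w with _ | ⟨b | a, w⟩
    · exact ⟨[Sum.inr g], ⟨by simpa using hg, by simp⟩, by simp [wordProd]⟩
    · refine ⟨Sum.inr g :: Sum.inl b :: w, ⟨?_, ?_⟩, by simp [wordProd]⟩
      · intro s hs
        rcases List.mem_cons.1 hs with rfl | hs
        · simpa using hg
        · exact hw1 s hs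
      · simpa using hw2
    · by_cases hga : g * a = 1
      · refine ⟨w, ⟨fun s hs => hw1 s (by simp [hs]), hw2.tail⟩, ?_⟩
        simp [wordProd, ← mul_assoc, ← map_mul, hga]
      · refine ⟨Sum.inr (g * a) :: w, ⟨?_, ?_⟩, by simp [wordProd, mul_assoc]⟩
        · intro s hs
          rcases List.mem_cons.1 hs with rfl | hs
          · simpa using hga
          · exact hw1 s (by simp [hs])
        · rcases w with _ | ⟨c, w⟩
          · simp
          · simpa using hw2

/-- The reduced word of an element of `G * H`. -/
noncomputable def reducedWord (x : Monoid.Coprod G H) : List (G ⊕ H) :=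
  (exists_reduced x).choose

theorem reducedWord_spec (x : Monoid.Coprod G H) :
    IsReduced (reducedWord x) ∧ wordProd (reducedWord x) = x :=
  (exists_reduced x).choose_spec

/-- The natural length on `G * H`: the sum of the lengths of the letters of the reduced word. -/
noncomputable def freeProductLength (lG : G → ℝ≥0) (lH : H → ℝ≥0) (x : Monoid.Coprod G H) : ℝ≥0 :=
  ((reducedWord x).map (Sum.elim lG lH)).sum

instance famGroup (b : Bool) : Group (Fam G H b) := by
  cases b
  · exact inferInstanceAs (Group (ULift.{u} H))
  · exact inferInstanceAs (Group (ULift.{v} G))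

/-- The comparison of the binary free product with the free product of the family. -/
def toCoprodI : Monoid.Coprod G H →* Monoid.CoprodI (Fam G H) :=
  Monoid.Coprod.lift
    ((Monoid.CoprodI.of (M := Fam G H) (i := true)).comp (MulEquiv.ulift.symm.toMonoidHom))
    ((Monoid.CoprodI.of (M := Fam G H) (i := false)).comp (MulEquiv.ulift.symm.toMonoidHom))

/-- Reduced words are determined by the elements they represent. -/
theorem reduced_unique {w w' : List (G ⊕ H)} (hw : IsReduced w) (hw' : IsReduced w')
    (h : wordProd w = wordProd w') : w = w' := by
  classical
  have key : ∀ w : List (G ⊕ H), IsReduced w → ∃ W : Monoid.CoprodI.Word (Fam G H),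
      W.toList = w.map letter ∧ W.prod = toCoprodI (wordProd w) := by
    intro w hw
    refine ⟨⟨w.map letter, ?_, ?_⟩, rfl, ?_⟩
    · intro l hl
      obtain ⟨s, hs, rfl⟩ := List.mem_map.1 hl
      have := hw.1 s hs
      rcases s with g | h
      · intro e
        exact this.1 (congrArg Sum.inl (congrArg ULift.down e))
      · intro e
        exact this.2 (congrArg Sum.inr (congrArg ULift.down e))
    · rw [List.isChain_map]
      refine hw.2.imp ?_
      rintro (_ | _) (_ | _) <;> simp [letter]
    · simp only [Monoid.CoprodI.Word.prod, wordProd, map_list_prod, List.map_map]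
      congr 1
      apply List.map_congr_left
      rintro (g | h) _ <;> rfl
  obtain ⟨W, hW, hWp⟩ := key w hw
  obtain ⟨W', hW', hWp'⟩ := key w' hw'
  have : W = W' := Monoid.CoprodI.Word.equiv.symm.injective
    (show W.prod = W'.prod by rw [hWp, hWp', h])
  exact List.map_injective_iff.2 letter_injective (by rw [← hW, ← hW', this])

theorem freeProductLength_wordProd (lG : G → ℝ≥0) (lH : H → ℝ≥0) {w : List (G ⊕ H)}
    (hw : IsReduced w) : freeProductLength lG lH (wordProd w) = (w.map (Sum.elim lG lH)).sum := by
  have h := reducedWord_spec (wordProd w)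
  rw [freeProductLength, reduced_unique h.1 hw h.2]

end FreeProduct

end SubexpDecay

/-! Everything is reduced to the form `∑ X(s) Y(t) Z(st)` with values in `[0, ∞]`, where sums
rearrange freely: bounding it by `C ‖X‖₂ ‖Y‖₂ ‖Z‖₂` for `X = |x|` bounds the operator norm of `x` by
`C ‖x‖₂`, and decay in a factor yields such a bound there.

In a product of reduced words `u v`, a block cancels: either `u = a b`, `v = b⁻¹ c` with `a c`
reduced, or `u = a s b`, `v = b⁻¹ t c` with `s`, `t` in one factor and `a (st) c` reduced
(`IsReduced.cancellation`). The form is at most the sum of three pieces (`tsum_le_words`).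

Each piece is a triangle sum `∑ A(a,b) B(b,c) C(a,c)`, bounded by the product of Hilbert–Schmidt
norms (`tsum_triangle_le`). In the merging pieces the inner sum over `s, t` is first estimated by
decay in the factor (`mergeSum_le`). If letters have length at least `1`, words in the support of
`X` have at most `D` letters, so `A`, `B`, `C` count each word once per admissible cut, costing a
square root of the number of cuts each (`l2norm_ite_le`). The total `(D+1)^{3/2} + (f_G(D) + f_H(D))
D^{3/2}` is at most `f(D)`.

For arbitrary lengths, each `l` is first replaced by `max(l, 1)` off the identity. -/

namespace SubexpDecay

open scoped ENNReal

/-! ### Norms of `[0, ∞]`-valued functions and the triangle estimate -/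

/-- The `ℓ²`-norm of a function with values in `[0, ∞]`. -/
noncomputable def l2norm {α : Type*} (u : α → ℝ≥0∞) : ℝ≥0∞ := (∑' a, u a ^ 2) ^ (1 / 2 : ℝ)

theorem l2norm_sq {α : Type*} (u : α → ℝ≥0∞) : l2norm u ^ 2 = ∑' a, u a ^ 2 := by
  rw [l2norm, ← ENNReal.rpow_natCast, ← ENNReal.rpow_mul]
  norm_num

theorem l2norm_le_of_tsum_le {α β : Type*} {u : α → ℝ≥0∞} {v : β → ℝ≥0∞} {N : ℝ≥0∞}
    (h : ∑' a, u a ^ 2 ≤ N * ∑' b, v b ^ 2) : l2norm u ≤ N ^ (1 / 2 : ℝ) * l2norm v := by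
  rw [l2norm, l2norm, ← ENNReal.mul_rpow_of_nonneg _ _ (by norm_num)]
  gcongr

theorem l2norm_comp_le {α β : Type*} {i : α → β} (hi : Function.Injective i) (u : β → ℝ≥0∞) :
    l2norm (fun a => u (i a)) ≤ l2norm u := by
  unfold l2norm
  gcongr
  exact ENNReal.tsum_comp_le_tsum_of_injective hi (fun b => u b ^ 2)

theorem l2norm_mul_prod {α β : Type*} (u : α → ℝ≥0∞) (v : β → ℝ≥0∞) :
    l2norm (fun p : α × β => u p.1 * v p.2) = l2norm u * l2norm v := by
  unfold l2norm
  rw [← ENNReal.mul_rpow_of_nonneg _ _ (by norm_num), ENNReal.tsum_prod']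
  simp_rw [mul_pow, ENNReal.tsum_mul_left, ENNReal.tsum_mul_right]

theorem l2norm_fiber {α β : Type*} (u : α × β → ℝ≥0∞) :
    l2norm (fun a => l2norm fun b => u (a, b)) = l2norm u := by
  rw [l2norm, l2norm, ENNReal.tsum_prod']
  simp_rw [l2norm_sq]

theorem l2norm_comp_equiv {α β : Type*} (e : α ≃ β) (u : β → ℝ≥0∞) :
    l2norm (fun a => u (e a)) = l2norm u := by
  unfold l2norm
  rw [e.tsum_eq (fun b => u b ^ 2)]

theorem tsum_mul_le_l2norm {α : Type*} (u v : α → ℝ≥0∞) :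
    ∑' a, u a * v a ≤ l2norm u * l2norm v := by
  let _ : MeasurableSpace α := ⊤
  have h := ENNReal.lintegral_mul_le_Lp_mul_Lq (MeasureTheory.Measure.count : MeasureTheory.Measure α)
    Real.HolderConjugate.two_two (f := u) (g := v)
    (measurable_from_top).aemeasurable (measurable_from_top).aemeasurable
  simpa [MeasureTheory.lintegral_count' measurable_from_top, l2norm] using h

/-- Cauchy–Schwarz in `b` for fixed `(a, c)`, then in `(a, c)`: the trace of a product of three
Hilbert–Schmidt kernels. -/
theorem tsum_triangle_le {α β γ : Type*} (A : α × β → ℝ≥0∞) (B : β × γ → ℝ≥0∞)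
    (C : α × γ → ℝ≥0∞) :
    ∑' (a) (b) (c), A (a, b) * B (b, c) * C (a, c) ≤ l2norm A * l2norm B * l2norm C := by
  calc ∑' (a) (b) (c), A (a, b) * B (b, c) * C (a, c)
      = ∑' p : α × γ, (∑' b, A (p.1, b) * B (b, p.2)) * C p := by
        rw [ENNReal.tsum_prod']
        refine tsum_congr fun a => ?_
        rw [ENNReal.tsum_comm]
        exact tsum_congr fun c => ENNReal.tsum_mul_right
    _ ≤ ∑' p : α × γ, (l2norm (fun b => A (p.1, b)) * l2norm (fun b => B (b, p.2))) * C p := by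
        gcongr with p
        exact tsum_mul_le_l2norm _ _
    _ ≤ l2norm (fun p : α × γ => l2norm (fun b => A (p.1, b)) * l2norm (fun b => B (b, p.2)))
          * l2norm C := tsum_mul_le_l2norm _ _
    _ = l2norm A * l2norm B * l2norm C := by
        rw [l2norm_mul_prod (fun a => l2norm fun b => A (a, b)) (fun c => l2norm fun b => B (b, c)),
          l2norm_fiber A, l2norm_fiber (fun p : γ × β => B (p.2, p.1)),
          show l2norm (fun p : γ × β => B (p.2, p.1)) = l2norm B from
            l2norm_comp_equiv (Equiv.prodComm γ β) B]

/-! ### Operator norm and trilinear forms -/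

theorem enorm_eq_l2norm {G : Type*} (ξ : Ell2 G) : ‖ξ‖ₑ = l2norm (fun g => ‖(ξ : G → ℂ) g‖ₑ) := by
  have h2 : 0 < (2 : ℝ≥0∞).toReal := by norm_num
  have hs := lp.hasSum_norm h2 ξ
  rw [l2norm, ← ofReal_norm, lp.norm_eq_tsum_rpow h2,
    ← ENNReal.ofReal_rpow_of_nonneg (tsum_nonneg fun _ => by positivity) (by norm_num),
    ENNReal.ofReal_tsum_of_nonneg (fun _ => by positivity) hs.summable]
  simp only [ENNReal.toReal_ofNat, Real.rpow_ofNat, ENNReal.ofReal_pow (norm_nonneg _), ofReal_norm]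

theorem ofReal_twoNorm {G : Type*} (x : MonoidAlgebra ℂ G) :
    ENNReal.ofReal (twoNorm x) = l2norm (fun g => ‖x.coeff g‖ₑ) := by
  rw [l2norm, twoNorm, Real.sqrt_eq_rpow,
    ← ENNReal.ofReal_rpow_of_nonneg (by positivity) (by norm_num),
    ENNReal.ofReal_sum_of_nonneg (fun _ _ => by positivity), tsum_eq_sum (s := x.coeff.support)]
  · simp only [ENNReal.ofReal_pow (norm_nonneg _), ofReal_norm]
  · intro g hg
    simp [Finsupp.notMem_support_iff.1 hg]

theorem tsum_fin_support {G : Type*} (x : G →₀ ℂ) (φ : G → ℝ≥0∞) :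
    ∑' g, ‖x g‖ₑ * φ g = ∑ g ∈ x.support, ‖x g‖ₑ * φ g := by
  refine tsum_eq_sum fun g hg => ?_
  simp [Finsupp.notMem_support_iff.1 hg]

section Rep

variable {G : Type*} [Group G]

theorem regularRep_apply (x : MonoidAlgebra ℂ G) (ξ : Ell2 G) (k : G) :
    (regularRep x ξ : G → ℂ) k = ∑ g ∈ x.coeff.support, x.coeff g * (ξ : G → ℂ) (g⁻¹ * k) := by
  rw [regularRep, MonoidAlgebra.lift_apply, Finsupp.sum, sum_apply,
    lp.coeFn_sum, Finset.sum_apply]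
  rfl

theorem tsum_tsum_mul_eq (X Y Z : G → ℝ≥0∞) :
    ∑' (s) (t), X s * Y t * Z (s * t) = ∑' k, (∑' s, X s * Y (s⁻¹ * k)) * Z k := by
  simp_rw [← ENNReal.tsum_mul_right]
  conv_rhs => rw [ENNReal.tsum_comm]
  refine tsum_congr fun s => ?_
  conv_rhs => rw [← (Equiv.mulLeft s).tsum_eq]
  simp

/-- A trilinear estimate bounds the operator norm. -/
theorem opNorm_le_of_trilinear (x : MonoidAlgebra ℂ G) (C : ℝ≥0)
    (h : ∀ Y Z : G → ℝ≥0∞, l2norm Y ≠ ∞ → ∑' (s) (t), ‖x.coeff s‖ₑ * Y t * Z (s * t) ≤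
      C * l2norm (fun g => ‖x.coeff g‖ₑ) * l2norm Y * l2norm Z) :
    opNorm x ≤ C * twoNorm x := by
  have h0 : 0 ≤ twoNorm x := Real.sqrt_nonneg _
  refine ContinuousLinearMap.opNorm_le_bound _ (by positivity) fun ξ => ?_
  set η := regularRep x ξ with hη
  -- The estimate is tested on `Z = |η|`; a factor `‖η‖` is then divided out.
  have key : ‖η‖ₑ ^ 2 ≤ (C * l2norm (fun g => ‖x.coeff g‖ₑ) * ‖ξ‖ₑ) * ‖η‖ₑ := by
    calc ‖η‖ₑ ^ 2 = ∑' k, ‖(η : G → ℂ) k‖ₑ * ‖(η : G → ℂ) k‖ₑ := by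
          rw [enorm_eq_l2norm, l2norm_sq]; simp_rw [sq]
      _ ≤ ∑' k, (∑' s, ‖x.coeff s‖ₑ * ‖(ξ : G → ℂ) (s⁻¹ * k)‖ₑ) * ‖(η : G → ℂ) k‖ₑ := by
          gcongr with k
          rw [tsum_fin_support x.coeff, hη, regularRep_apply]
          refine (enorm_sum_le _ _).trans (Finset.sum_le_sum fun g _ => ?_)
          rw [enorm_mul]
      _ = ∑' (s) (t), ‖x.coeff s‖ₑ * ‖(ξ : G → ℂ) t‖ₑ * ‖(η : G → ℂ) (s * t)‖ₑ :=
          (tsum_tsum_mul_eq (fun s => ‖x.coeff s‖ₑ) (fun t => ‖(ξ : G → ℂ) t‖ₑ)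
            fun k => ‖(η : G → ℂ) k‖ₑ).symm
      _ ≤ _ := by
          rw [enorm_eq_l2norm ξ, enorm_eq_l2norm η]
          refine h _ (fun k => ‖(η : G → ℂ) k‖ₑ) ?_
          rw [← enorm_eq_l2norm]
          exact enorm_ne_top
  rw [← ofReal_twoNorm, ← ofReal_norm, ← ofReal_norm, ← ENNReal.ofReal_coe_nnreal,
    ← ENNReal.ofReal_mul (by positivity), ← ENNReal.ofReal_mul (by positivity),
    ← ENNReal.ofReal_mul (by positivity), ← ENNReal.ofReal_pow (by positivity),
    ENNReal.ofReal_le_ofReal_iff (by positivity), sq] at key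
  rcases (norm_nonneg η).eq_or_lt with h0 | hp
  · rw [← h0]; positivity
  · exact le_of_mul_le_mul_right key hp

/-- Decay gives a trilinear estimate for functions supported in a ball. -/
theorem HasSD.trilinear {l : G → ℝ≥0} {f : ℕ → ℝ≥0} (h : HasSD l f) (D : ℕ)
    (X Y Z : G → ℝ≥0∞) (hfin : (Function.support X).Finite) (htop : ∀ s, X s ≠ ∞)
    (hX : ∀ s, X s ≠ 0 → l s ≤ D) (hY : l2norm Y ≠ ∞) :
    ∑' (s) (t), X s * Y t * Z (s * t) ≤ f D * l2norm X * l2norm Y * l2norm Z := by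
  classical
  have h2 : 0 < (2 : ℝ≥0∞).toReal := by norm_num
  have hYs : ∑' t, Y t ^ 2 ≠ ∞ := by
    rw [← l2norm_sq]; exact ENNReal.pow_ne_top hY
  have hYt : ∀ t, Y t ≠ ∞ := fun t ht => by
    refine ENNReal.ne_top_of_tsum_ne_top hYs t ?_
    simp [ht]
  have hmem : Memℓp (fun t => (((Y t).toReal : ℝ) : ℂ)) 2 := by
    rw [memℓp_gen_iff h2]
    simpa using ENNReal.summable_toReal hYs
  let ξ : Ell2 G := ⟨_, hmem⟩
  have hξ : ∀ t, ‖(ξ : G → ℂ) t‖ₑ = Y t := fun t => by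
    change ‖(((Y t).toReal : ℝ) : ℂ)‖ₑ = Y t
    rw [← ofReal_norm]; simp [hYt t]
  let x : MonoidAlgebra ℂ G := .ofCoeff
    (Finsupp.ofSupportFinite (fun s => (((X s).toReal : ℝ) : ℂ))
      (hfin.subset fun s hs => by
        simp only [Function.mem_support] at hs ⊢
        rintro h0; simp [h0] at hs))
  have hxc : ∀ s, x.coeff s = (((X s).toReal : ℝ) : ℂ) := fun s => rfl
  have hx : ∀ s, ‖x.coeff s‖ₑ = X s := fun s => by
    rw [hxc, ← ofReal_norm]; simp [htop s]
  have hdec := h.decay D x fun g hg => hX g fun h0 => by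
    rw [Finsupp.mem_support_iff, hxc, h0] at hg
    simp at hg
  have hop : ‖regularRep x ξ‖ₑ ≤ f D * l2norm X * l2norm Y := by
    have h1 : ‖regularRep x ξ‖ ≤ f D * twoNorm x * ‖ξ‖ :=
      ((regularRep x).le_opNorm ξ).trans (by gcongr; exact hdec)
    have h3 := ENNReal.ofReal_le_ofReal h1
    rw [ofReal_norm, ENNReal.ofReal_mul (mul_nonneg (by positivity) (show 0 ≤ twoNorm x from Real.sqrt_nonneg _)),
      ENNReal.ofReal_mul (by positivity),
      ofReal_twoNorm, ofReal_norm, enorm_eq_l2norm ξ, ENNReal.ofReal_coe_nnreal] at h3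
    simpa only [hx, hξ] using h3
  rw [tsum_tsum_mul_eq]
  -- All coefficients are nonnegative, so taking moduli loses nothing and the convolution is exactly
  -- `|λ(x) ξ|`.
  have hk : ∀ k, ∑' s, X s * Y (s⁻¹ * k) = ‖(regularRep x ξ : G → ℂ) k‖ₑ := fun k => by
    have hnn : (regularRep x ξ : G → ℂ) k
        = ((∑ g ∈ x.coeff.support, (X g).toReal * (Y (g⁻¹ * k)).toReal : ℝ) : ℂ) := by
      rw [regularRep_apply]
      push_cast
      exact Finset.sum_congr rfl fun g _ => by rw [hxc]
    rw [hnn, ← ofReal_norm, Complex.norm_real, Real.norm_of_nonneg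
      (Finset.sum_nonneg fun _ _ => by positivity),
      ENNReal.ofReal_sum_of_nonneg (fun _ _ => by positivity)]
    simp_rw [← hx]
    rw [tsum_fin_support]
    refine Finset.sum_congr rfl fun g _ => ?_
    rw [ENNReal.ofReal_mul (by positivity), ENNReal.ofReal_toReal (by simp), ENNReal.ofReal_toReal (hYt _)]
  simp_rw [hk]
  refine (tsum_mul_le_l2norm _ _).trans ?_
  rw [← enorm_eq_l2norm]
  gcongr

/-- The trilinear estimate is tested on three point masses at the identity. -/
theorem HasSD.one_le {l : G → ℝ≥0} {f : ℕ → ℝ≥0} (h : HasSD l f) (D : ℕ) : 1 ≤ f D := by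
  classical
  have := h.trilinear D (Pi.single 1 1) (Pi.single 1 1) (Pi.single 1 1)
    ((Set.finite_singleton 1).subset (by
      intro s hs
      by_contra hne
      simp at hne
      simp [hne] at hs))
    (fun s => by by_cases hs : s = 1 <;> simp [hs])
    (fun s hs => by
      have : s = 1 := by
        by_contra hne
        simp [hne] at hs
      simp [this, h.isLength.map_one])
  have hl : l2norm (Pi.single (1 : G) (1 : ℝ≥0∞)) = 1 := by
    rw [l2norm, tsum_eq_single 1] <;> simp +contextual
  rw [hl] at this
  have h1 := (ENNReal.le_tsum (f := fun s => ∑' t, (Pi.single (1 : G) (1 : ℝ≥0∞) : G → ℝ≥0∞) s * (Pi.single (1 : G) (1 : ℝ≥0∞) : G → ℝ≥0∞) t * (Pi.single (1 : G) (1 : ℝ≥0∞) : G → ℝ≥0∞) (s * t)) 1).trans (this (by simp))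
  have h2 := (ENNReal.le_tsum 1).trans h1
  simpa using h2

end Rep
-- Reduced words, cancellation and the free-product length
section Words

variable {G H : Type*} [Group G] [Group H]

/-- The formal inverse of a word. -/
def invWord (w : List (G ⊕ H)) : List (G ⊕ H) :=
  (w.map (Sum.map (·⁻¹) (·⁻¹))).reverse

@[simp] theorem invWord_nil : invWord ([] : List (G ⊕ H)) = [] := rfl

@[simp] theorem invWord_append (a b : List (G ⊕ H)) :
    invWord (a ++ b) = invWord b ++ invWord a := by simp [invWord]

@[simp] theorem length_invWord (w : List (G ⊕ H)) : (invWord w).length = w.length := by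
  simp [invWord]

@[simp] theorem invWord_singleton (s : G ⊕ H) : invWord [s] = [Sum.map (·⁻¹) (·⁻¹) s] := rfl

theorem invWord_invWord (w : List (G ⊕ H)) : invWord (invWord w) = w := by
  simp [invWord, List.map_reverse, Function.comp_def]

theorem invWord_injective : Function.Injective (invWord : List (G ⊕ H) → List (G ⊕ H)) :=
  Function.LeftInverse.injective invWord_invWord

@[simp] theorem wordProd_nil : wordProd ([] : List (G ⊕ H)) = 1 := rfl

@[simp] theorem wordProd_append (a b : List (G ⊕ H)) :
    wordProd (a ++ b) = wordProd a * wordProd b := by simp [wordProd]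

@[simp] theorem wordProd_cons (s : G ⊕ H) (b : List (G ⊕ H)) :
    wordProd (s :: b) = s.elim (fun g => .inl g) (fun h => .inr h) * wordProd b := by
  simp [wordProd]

@[simp] theorem wordProd_invWord (w : List (G ⊕ H)) : wordProd (invWord w) = (wordProd w)⁻¹ := by
  induction w with
  | nil => simp
  | cons s w ih =>
    rw [← List.singleton_append, invWord_append, wordProd_append, ih, invWord_singleton]
    rcases s with s | s <;> simp

/-- Alternation depends only on the factors of the letters, so inverting or replacing letters within
their factors leaves it intact. -/
theorem isReduced_iff_isChain_map {w : List (G ⊕ H)} :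
    IsReduced w ↔ (∀ s ∈ w, s ≠ Sum.inl 1 ∧ s ≠ Sum.inr 1) ∧ (w.map Sum.isLeft).IsChain (· ≠ ·) := by
  rw [IsReduced, List.isChain_map]

theorem IsReduced.left {a b : List (G ⊕ H)} (h : IsReduced (a ++ b)) : IsReduced a :=
  ⟨fun s hs => h.1 s (by simp [hs]), h.2.left_of_append⟩

theorem IsReduced.right {a b : List (G ⊕ H)} (h : IsReduced (a ++ b)) : IsReduced b :=
  ⟨fun s hs => h.1 s (by simp [hs]), h.2.right_of_append⟩

theorem IsReduced.invWord {w : List (G ⊕ H)} (h : IsReduced w) : IsReduced (invWord w) := by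
  rw [isReduced_iff_isChain_map] at h ⊢
  refine ⟨fun s hs => ?_, ?_⟩
  · simp only [SubexpDecay.invWord, List.mem_reverse, List.mem_map] at hs
    obtain ⟨t, ht, rfl⟩ := hs
    have := h.1 t ht
    rcases t with t | t <;> simpa using this
  · have hm : (SubexpDecay.invWord w).map Sum.isLeft = (w.map Sum.isLeft).reverse := by
      simp [SubexpDecay.invWord, List.map_reverse, Function.comp_def]
    rw [hm, List.isChain_reverse]
    exact h.2.imp fun _ _ h => h.symm

/-- Gluing two reduced words along letters of the same factor. -/
theorem IsReduced.glue {a c : List (G ⊕ H)} {s t r : G ⊕ H} (ha : IsReduced (a ++ [s]))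
    (hc : IsReduced (t :: c)) (hs : s.isLeft = r.isLeft) (ht : t.isLeft = r.isLeft)
    (hr : r ≠ Sum.inl 1 ∧ r ≠ Sum.inr 1) : IsReduced (a ++ r :: c) := by
  rw [isReduced_iff_isChain_map] at *
  refine ⟨fun x hx => ?_, ?_⟩
  · rcases List.mem_append.1 hx with h | h
    · exact ha.1 x (by simp [h])
    · rcases List.mem_cons.1 h with rfl | h
      · exact hr
      · exact hc.1 x (by simp [h])
  · have h1 := ha.2
    have h2 := hc.2
    simp only [List.map_append, List.map_cons, List.map_nil, hs, ht] at h1 h2 ⊢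
    exact List.isChain_split.2 ⟨h1, h2⟩

theorem IsReduced.append_of_ne {a c : List (G ⊕ H)} {s t : G ⊕ H} (ha : IsReduced (a ++ [s]))
    (hc : IsReduced (t :: c)) (hst : s.isLeft ≠ t.isLeft) : IsReduced ((a ++ [s]) ++ t :: c) := by
  refine ⟨fun x hx => ?_, ?_⟩
  · rcases List.mem_append.1 hx with h | h
    · exact ha.1 x h
    · exact hc.1 x h
  · rw [List.append_assoc, List.singleton_append]
    exact List.isChain_split.2 ⟨ha.2, List.isChain_cons_cons.2 ⟨hst, hc.2⟩⟩

/-- The shape of the cancellation in the product of two reduced words. -/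
theorem IsReduced.cancellation {u v : List (G ⊕ H)} (hu : IsReduced u) (hv : IsReduced v) :
    (∃ a b c, u = a ++ b ∧ v = SubexpDecay.invWord b ++ c ∧ IsReduced (a ++ c)) ∨
    (∃ a b c s t, u = a ++ Sum.inl s :: b ∧ v = SubexpDecay.invWord b ++ Sum.inl t :: c ∧
      IsReduced (a ++ Sum.inl (s * t) :: c)) ∨
    (∃ a b c s t, u = a ++ Sum.inr s :: b ∧ v = SubexpDecay.invWord b ++ Sum.inr t :: c ∧
      IsReduced (a ++ Sum.inr (s * t) :: c)) := by
  induction u using List.reverseRecOn generalizing v with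
  | nil => exact Or.inl ⟨[], [], v, by simp, by simp, by simpa using hv⟩
  | append_singleton u s ih =>
    rcases v with _ | ⟨t, v⟩
    · exact Or.inl ⟨u ++ [s], [], [], by simp, by simp, by simpa using hu⟩
    have hu' := hu.left
    have hv' : IsReduced v := IsReduced.right (a := [t]) hv
    -- If the adjacent letters are inverse they join the cancelled block and the induction
    -- continues. Otherwise cancellation stops here: the letters merge or stand side by side
    -- according to their factors.
    by_cases hts : t = Sum.map (·⁻¹) (·⁻¹) s
    · rcases ih hu' hv' with ⟨a, b, c, h1, h2, h3⟩ | ⟨a, b, c, p, q, h1, h2, h3⟩ |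
        ⟨a, b, c, p, q, h1, h2, h3⟩
      · exact Or.inl ⟨a, b ++ [s], c, by simp [h1], by simp [h2, hts], h3⟩
      · exact Or.inr (Or.inl ⟨a, b ++ [s], c, p, q, by simp [h1], by simp [h2, hts], h3⟩)
      · exact Or.inr (Or.inr ⟨a, b ++ [s], c, p, q, by simp [h1], by simp [h2, hts], h3⟩)
    rcases s with s | s <;> rcases t with t | t
    · have hst : s * t ≠ 1 := fun h => hts (by simp [eq_inv_of_mul_eq_one_right h])
      exact Or.inr (Or.inl ⟨u, [], v, s, t, by simp, by simp,
        hu.glue hv rfl rfl (by simpa using hst)⟩)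
    · exact Or.inl ⟨_, [], _, by simp, by simp, hu.append_of_ne hv (by simp)⟩
    · exact Or.inl ⟨_, [], _, by simp, by simp, hu.append_of_ne hv (by simp)⟩
    · have hst : s * t ≠ 1 := fun h => hts (by simp [eq_inv_of_mul_eq_one_right h])
      exact Or.inr (Or.inr ⟨u, [], v, s, t, by simp, by simp,
        hu.glue hv rfl rfl (by simpa using hst)⟩)

theorem countable_coprod [Countable G] [Countable H] : Countable (Monoid.Coprod G H) :=
  Function.Surjective.countable (f := (wordProd : List (G ⊕ H) → _)) fun x =>
    ⟨reducedWord x, (reducedWord_spec x).2⟩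

theorem isLength_freeProductLength {lG : G → ℝ≥0} {lH : H → ℝ≥0} (hG : IsLength lG)
    (hH : IsLength lH) : IsLength (freeProductLength lG lH) := by
  have hinv : ∀ w : List (G ⊕ H), ((invWord w).map (Sum.elim lG lH)).sum
      = (w.map (Sum.elim lG lH)).sum := fun w => by
    rw [invWord, List.map_reverse, List.sum_reverse, List.map_map]
    congr 2
    funext s
    rcases s with s | s
    · exact hG.map_inv s
    · exact hH.map_inv s
  refine ⟨?_, fun x => ?_, fun x y => ?_⟩
  · simpa using freeProductLength_wordProd lG lH (w := []) ⟨by simp, by simp⟩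
  · obtain ⟨w, hw, rfl⟩ := exists_reduced x
    rw [← wordProd_invWord, freeProductLength_wordProd lG lH hw,
      freeProductLength_wordProd lG lH hw.invWord, hinv]
  · obtain ⟨u, hu, rfl⟩ := exists_reduced x
    obtain ⟨v, hv, rfl⟩ := exists_reduced y
    rw [freeProductLength_wordProd lG lH hu, freeProductLength_wordProd lG lH hv]
    rcases hu.cancellation hv with ⟨a, b, c, rfl, rfl, h⟩ | ⟨a, b, c, s, t, rfl, rfl, h⟩ |
      ⟨a, b, c, s, t, rfl, rfl, h⟩
    · rw [show wordProd (a ++ b) * wordProd (invWord b ++ c) = wordProd (a ++ c) by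
        simp [mul_assoc], freeProductLength_wordProd lG lH h]
      simp only [List.map_append, List.sum_append]
      gcongr <;> simp
    · rw [show wordProd (a ++ Sum.inl s :: b) * wordProd (invWord b ++ Sum.inl t :: c)
        = wordProd (a ++ Sum.inl (s * t) :: c) by simp [mul_assoc],
        freeProductLength_wordProd lG lH h]
      have := hG.map_mul_le s t
      simp only [List.map_append, List.sum_append, List.map_cons, List.sum_cons, Sum.elim_inl, hinv]
      -- The cancelled block occurs in both words and leaves the slack of twice its length.
      calc _ ≤ (a.map (Sum.elim lG lH)).sum + ((lG s + lG t) + (c.map (Sum.elim lG lH)).sum)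
            + 2 * (b.map (Sum.elim lG lH)).sum := by
              refine le_add_right ?_
              gcongr
        _ = _ := by ring
    · rw [show wordProd (a ++ Sum.inr s :: b) * wordProd (invWord b ++ Sum.inr t :: c)
        = wordProd (a ++ Sum.inr (s * t) :: c) by simp [mul_assoc],
        freeProductLength_wordProd lG lH h]
      have := hH.map_mul_le s t
      simp only [List.map_append, List.sum_append, List.map_cons, List.sum_cons, Sum.elim_inr, hinv]
      calc _ ≤ (a.map (Sum.elim lG lH)).sum + ((lH s + lH t) + (c.map (Sum.elim lG lH)).sum)
            + 2 * (b.map (Sum.elim lG lH)).sum := by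
              refine le_add_right ?_
              gcongr
        _ = _ := by ring

end Words
-- Sums over words and the two kinds of cancellation
/-- A function counted at most `N` times has `ℓ²`-norm at most `√N` times the original one. -/
theorem l2norm_ite_le {S W : Type*} (m : S → W) (k : S → ℕ) (N : ℕ)
    (hinj : Function.Injective fun s => (k s, m s)) (Φ : W → ℝ≥0∞) :
    l2norm (fun s => if k s < N then Φ (m s) else 0) ≤ (N : ℝ≥0∞) ^ (1 / 2 : ℝ) * l2norm Φ := by
  refine l2norm_le_of_tsum_le ?_
  -- The sum is split by the value of `k`; `m` is injective on each of the `N` fibres.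
  have h : ∀ s, (if k s < N then Φ (m s) else 0) ^ 2
      = ∑ n ∈ Finset.range N, if k s = n then Φ (m s) ^ 2 else 0 := fun s => by
    rw [Finset.sum_ite_eq]
    by_cases hs : k s < N <;> simp [hs]
  simp_rw [h]
  rw [Summable.tsum_finsetSum fun _ _ => ENNReal.summable, ← nsmul_eq_mul]
  refine (Finset.sum_le_card_nsmul _ _ (∑' w, Φ w ^ 2) fun n _ => ?_).trans (by simp)
  have hsub : ∑' s, (if k s = n then Φ (m s) ^ 2 else 0)
      = ∑' s : {s | k s = n}, Φ (m s) ^ 2 := by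
    rw [tsum_subtype {s | k s = n} fun s => Φ (m s) ^ 2]
    exact tsum_congr fun s => by simp [Set.indicator_apply]
  rw [hsub]
  refine ENNReal.tsum_comp_le_tsum_of_injective (f := fun s : {s | k s = n} => m s)
    (fun s t hst => Subtype.ext (hinj ?_)) fun w => Φ w ^ 2
  exact Prod.ext (s.2.trans t.2.symm) hst

section Words

variable {G H : Type*} [Group G] [Group H]

open Classical in
/-- A function on the free product as a function on words, supported on reduced words. -/
noncomputable def onWords (x : Monoid.Coprod G H → ℝ≥0∞) (w : List (G ⊕ H)) : ℝ≥0∞ :=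
  if IsReduced w then x (wordProd w) else 0

theorem onWords_of_isReduced (x : Monoid.Coprod G H → ℝ≥0∞) {w : List (G ⊕ H)}
    (h : IsReduced w) : onWords x w = x (wordProd w) := if_pos h

theorem isReduced_of_onWords_ne_zero {x : Monoid.Coprod G H → ℝ≥0∞} {w : List (G ⊕ H)}
    (h : onWords x w ≠ 0) : IsReduced w := by
  by_contra hw
  exact h (if_neg hw)

/-- By uniqueness of reduced words, each group element is counted at most once. -/
theorem l2norm_onWords_le (x : Monoid.Coprod G H → ℝ≥0∞) : l2norm (onWords x) ≤ l2norm x := by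
  unfold l2norm
  gcongr
  have : ∑' w, onWords x w ^ 2 = ∑' w : {w : List (G ⊕ H) | IsReduced w}, x (wordProd w) ^ 2 := by
    rw [tsum_subtype {w | IsReduced w} fun w => x (wordProd w) ^ 2]
    refine tsum_congr fun w => ?_
    by_cases hw : IsReduced w <;> simp [onWords, hw]
  rw [this]
  exact ENNReal.tsum_comp_le_tsum_of_injective
    (f := fun w : {w : List (G ⊕ H) | IsReduced w} => wordProd (w : List (G ⊕ H)))
    (fun u v huv => Subtype.ext (reduced_unique u.2 v.2 huv)) fun g => x g ^ 2

theorem finite_support_onWords {x : Monoid.Coprod G H → ℝ≥0∞} (hx : (Function.support x).Finite) :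
    (Function.support (onWords x)).Finite := by
  refine (hx.image reducedWord).subset fun w hw => ?_
  have hr := isReduced_of_onWords_ne_zero hw
  refine ⟨wordProd w, ?_, reduced_unique (reducedWord_spec _).1 hr (reducedWord_spec _).2⟩
  rw [Function.mem_support, onWords_of_isReduced x hr] at hw
  exact hw

/-- The terms of a product in which letters merge, for an embedded factor `ι`. -/
noncomputable def mergeSum {Γ : Type*} [Group Γ] (ι : Γ → G ⊕ H) (X Y Z : List (G ⊕ H) → ℝ≥0∞) :
    ℝ≥0∞ :=
  ∑' (a) (b) (c) (s) (t), X (a ++ ι s :: b) * Y (invWord b ++ ι t :: c) * Z (a ++ ι (s * t) :: c)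

theorem tsum_prod₃ {α β γ : Type*} (φ : α → β → γ → ℝ≥0∞) :
    ∑' p : α × β × γ, φ p.1 p.2.1 p.2.2 = ∑' (a) (b) (c), φ a b c := by
  simp_rw [ENNReal.tsum_prod']

theorem tsum_prod₅ {α β γ δ ε : Type*} (φ : α → β → γ → δ → ε → ℝ≥0∞) :
    ∑' p : α × β × γ × δ × ε, φ p.1 p.2.1 p.2.2.1 p.2.2.2.1 p.2.2.2.2
      = ∑' (a) (b) (c) (d) (e), φ a b c d e := by
  simp_rw [ENNReal.tsum_prod']

/-- One cancellation pattern is chosen for each pair `(g, h)`. The pattern determines the pair (`π`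
is a left inverse), so the choice is injective, and all other terms on the right are nonnegative;
uniqueness of the pattern is not needed. -/
theorem tsum_le_words (x y z : Monoid.Coprod G H → ℝ≥0∞) :
    ∑' (g) (h), x g * y h * z (g * h) ≤
      ∑' (a) (b) (c), onWords x (a ++ b) * onWords y (invWord b ++ c) * onWords z (a ++ c)
      + (mergeSum (Sum.inl : G → G ⊕ H) (onWords x) (onWords y) (onWords z)
      + mergeSum (Sum.inr : H → G ⊕ H) (onWords x) (onWords y) (onWords z)) := by
  let L := List (G ⊕ H)
  let ψ : (L × L × L) ⊕ ((L × L × L × G × G) ⊕ (L × L × L × H × H)) → ℝ≥0∞ :=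
    Sum.elim
      (fun p => onWords x (p.1 ++ p.2.1) * onWords y (invWord p.2.1 ++ p.2.2)
        * onWords z (p.1 ++ p.2.2))
      (Sum.elim
        (fun p => onWords x (p.1 ++ Sum.inl p.2.2.2.1 :: p.2.1)
          * onWords y (invWord p.2.1 ++ Sum.inl p.2.2.2.2 :: p.2.2.1)
          * onWords z (p.1 ++ Sum.inl (p.2.2.2.1 * p.2.2.2.2) :: p.2.2.1))
        (fun p => onWords x (p.1 ++ Sum.inr p.2.2.2.1 :: p.2.1)
          * onWords y (invWord p.2.1 ++ Sum.inr p.2.2.2.2 :: p.2.2.1)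
          * onWords z (p.1 ++ Sum.inr (p.2.2.2.1 * p.2.2.2.2) :: p.2.2.1)))
  let π : (L × L × L) ⊕ ((L × L × L × G × G) ⊕ (L × L × L × H × H)) →
      Monoid.Coprod G H × Monoid.Coprod G H :=
    Sum.elim
      (fun p => (wordProd (p.1 ++ p.2.1), wordProd (invWord p.2.1 ++ p.2.2)))
      (Sum.elim
        (fun p => (wordProd (p.1 ++ Sum.inl p.2.2.2.1 :: p.2.1),
          wordProd (invWord p.2.1 ++ Sum.inl p.2.2.2.2 :: p.2.2.1)))
        (fun p => (wordProd (p.1 ++ Sum.inr p.2.2.2.1 :: p.2.1),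
          wordProd (invWord p.2.1 ++ Sum.inr p.2.2.2.2 :: p.2.2.1))))
  have hex : ∀ p : Monoid.Coprod G H × Monoid.Coprod G H,
      ∃ i, π i = p ∧ ψ i = x p.1 * y p.2 * z (p.1 * p.2) := by
    rintro ⟨g, h⟩
    obtain ⟨u, hu, rfl⟩ := exists_reduced g
    obtain ⟨v, hv, rfl⟩ := exists_reduced h
    rcases hu.cancellation hv with ⟨a, b, c, rfl, rfl, hr⟩ | ⟨a, b, c, s, t, rfl, rfl, hr⟩ |
      ⟨a, b, c, s, t, rfl, rfl, hr⟩
    · refine ⟨Sum.inl (a, b, c), rfl, ?_⟩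
      simp only [ψ, Sum.elim_inl, onWords_of_isReduced _ hu, onWords_of_isReduced _ hv,
        onWords_of_isReduced _ hr]
      simp [mul_assoc]
    · refine ⟨Sum.inr (Sum.inl (a, b, c, s, t)), rfl, ?_⟩
      simp only [ψ, Sum.elim_inl, Sum.elim_inr, onWords_of_isReduced _ hu,
        onWords_of_isReduced _ hv, onWords_of_isReduced _ hr]
      simp [mul_assoc]
    · refine ⟨Sum.inr (Sum.inr (a, b, c, s, t)), rfl, ?_⟩
      simp only [ψ, Sum.elim_inr, onWords_of_isReduced _ hu,
        onWords_of_isReduced _ hv, onWords_of_isReduced _ hr]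
      simp [mul_assoc]
  choose i hπ hψ using hex
  calc ∑' (g) (h), x g * y h * z (g * h)
      = ∑' p : Monoid.Coprod G H × Monoid.Coprod G H, ψ (i p) := by
        simp_rw [hψ]
        rw [ENNReal.tsum_prod']
    _ ≤ ∑' j, ψ j :=
        ENNReal.tsum_comp_le_tsum_of_injective (Function.LeftInverse.injective (g := π) hπ) ψ
    _ = _ := by
        rw [Summable.tsum_sum ENNReal.summable ENNReal.summable,
          Summable.tsum_sum ENNReal.summable ENNReal.summable, mergeSum, mergeSum,
          ← tsum_prod₃, ← tsum_prod₅, ← tsum_prod₅]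
        rfl

theorem cancelSum_le (D : ℕ) (X Y Z : List (G ⊕ H) → ℝ≥0∞) (hX : ∀ w, X w ≠ 0 → w.length ≤ D) :
    ∑' (a) (b) (c), X (a ++ b) * Y (invWord b ++ c) * Z (a ++ c) ≤
      (((D + 1 : ℕ) : ℝ≥0∞) ^ (1 / 2 : ℝ)) ^ 3 * (l2norm X * l2norm Y * l2norm Z) := by
  let L := List (G ⊕ H)
  let A : L × L → ℝ≥0∞ := fun p => if p.1.length < D + 1 then X (p.1 ++ p.2) else 0
  let B : L × L → ℝ≥0∞ := fun p => if p.1.length < D + 1 then Y (invWord p.1 ++ p.2) else 0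
  let C : L × L → ℝ≥0∞ := fun p => if p.1.length < D + 1 then Z (p.1 ++ p.2) else 0
  -- A word and the position of its cut determine the two pieces.
  have hinj : Function.Injective fun p : L × L => (p.1.length, p.1 ++ p.2) := fun p q hpq => by
    obtain ⟨h1, h2⟩ := Prod.mk.inj hpq
    exact Prod.ext_iff.2 (List.append_inj h2 h1)
  have hinj' : Function.Injective fun p : L × L => (p.1.length, invWord p.1 ++ p.2) :=
    fun p q hpq => by
      obtain ⟨h1, h2⟩ := Prod.mk.inj hpq
      obtain ⟨h3, h4⟩ := List.append_inj h2 (by simpa using h1)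
      exact Prod.ext (invWord_injective h3) h4
  calc ∑' (a) (b) (c), X (a ++ b) * Y (invWord b ++ c) * Z (a ++ c)
      ≤ ∑' (a) (b) (c), A (a, b) * B (b, c) * C (a, c) := by
        refine ENNReal.tsum_le_tsum fun a => ENNReal.tsum_le_tsum fun b =>
          ENNReal.tsum_le_tsum fun c => ?_
        -- The support of `X` bounds both `a` and `b`, hence the cuts in all three functions: `A`
        -- and `C` are cut after `a`, `B` after the inverse of `b`. There are `D + 1` cut positions,
        -- `0` to `D`.
        by_cases h0 : X (a ++ b) = 0
        · simp [h0]
        have hl := hX _ h0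
        rw [List.length_append] at hl
        simp only [A, B, C, if_pos (show a.length < D + 1 by omega),
          if_pos (show b.length < D + 1 by omega)]
        exact le_rfl
    _ ≤ l2norm A * l2norm B * l2norm C := tsum_triangle_le A B C
    _ ≤ _ := by
        refine (mul_le_mul' (mul_le_mul' (l2norm_ite_le _ _ _ hinj X)
          (l2norm_ite_le _ _ _ hinj' Y)) (l2norm_ite_le _ _ _ hinj Z)).trans (le_of_eq ?_)
        ring

/-- For fixed `a, b, c` the sum over `s, t` is a trilinear form on `Γ`, where decay applies. The
fibre norms that remain form a triangle sum. -/
theorem mergeSum_le {Γ : Type*} [Group Γ] {l : Γ → ℝ≥0} {f : ℕ → ℝ≥0} (h : HasSD l f)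
    {ι : Γ → G ⊕ H} (hι : Function.Injective ι) (D : ℕ) (X Y Z : List (G ⊕ H) → ℝ≥0∞)
    (hfin : (Function.support X).Finite) (htop : ∀ w, X w ≠ ∞)
    (hX : ∀ w, X w ≠ 0 → w.length ≤ D) (hl : ∀ a s b, X (a ++ ι s :: b) ≠ 0 → l s ≤ D)
    (hY : l2norm Y ≠ ∞) :
    mergeSum ι X Y Z ≤
      f D * (((D : ℝ≥0∞) ^ (1 / 2 : ℝ)) ^ 3 * (l2norm X * l2norm Y * l2norm Z)) := by
  let L := List (G ⊕ H)
  let A : (L × L) × Γ → ℝ≥0∞ := fun p =>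
    if p.1.1.length < D then X (p.1.1 ++ ι p.2 :: p.1.2) else 0
  let B : (L × L) × Γ → ℝ≥0∞ := fun p =>
    if p.1.1.length < D then Y (invWord p.1.1 ++ ι p.2 :: p.1.2) else 0
  let C : (L × L) × Γ → ℝ≥0∞ := fun p =>
    if p.1.1.length < D then Z (p.1.1 ++ ι p.2 :: p.1.2) else 0
  have hinj : Function.Injective fun p : (L × L) × Γ =>
      (p.1.1.length, p.1.1 ++ ι p.2 :: p.1.2) := fun p q hpq => by
    obtain ⟨h1, h2⟩ := Prod.mk.inj hpq
    obtain ⟨h3, h4⟩ := List.append_inj h2 h1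
    obtain ⟨h5, h6⟩ := List.cons.inj h4
    exact Prod.ext (Prod.ext h3 h6) (hι h5)
  have hinj' : Function.Injective fun p : (L × L) × Γ =>
      (p.1.1.length, invWord p.1.1 ++ ι p.2 :: p.1.2) := fun p q hpq => by
    obtain ⟨h1, h2⟩ := Prod.mk.inj hpq
    obtain ⟨h3, h4⟩ := List.append_inj h2 (by simpa using h1)
    obtain ⟨h5, h6⟩ := List.cons.inj h4
    exact Prod.ext (Prod.ext (invWord_injective h3) h6) (hι h5)
  have hsec : ∀ a b, Function.Injective fun s => a ++ ι s :: b := fun a b s t hst =>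
    hι (List.cons.inj (List.append_cancel_left hst)).1
  have hAX : ∀ a b s, A ((a, b), s) ≠ 0 → X (a ++ ι s :: b) ≠ 0 := fun a b s h0 hx =>
    h0 (by simp [A, hx])
  have hA : ∀ a b c, ∑' (s) (t), A ((a, b), s) * B ((b, c), t) * C ((a, c), s * t) ≤
      f D * l2norm (fun s => A ((a, b), s)) * l2norm (fun t => B ((b, c), t))
        * l2norm (fun r => C ((a, c), r)) := fun a b c => by
    refine h.trilinear D _ _ (fun r => C ((a, c), r)) ?_ (fun s => ?_)
      (fun s hs => hl a s b (hAX a b s hs)) ?_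
    · exact (hfin.preimage (hsec a b).injOn).subset fun s hs => hAX a b s hs
    · simp only [A]
      split_ifs
      exacts [htop _, ENNReal.zero_ne_top]
    -- `HasSD.trilinear` needs its second function in `ℓ²`; this one is dominated by a restriction
    -- of `Y`.
    · refine ne_top_of_le_ne_top hY (le_trans ?_ (l2norm_comp_le (hsec (invWord b) c) Y))
      unfold l2norm
      gcongr with t
      simp only [B]
      split_ifs
      exacts [le_rfl, zero_le]
  calc mergeSum ι X Y Z
      ≤ ∑' (a) (b) (c) (s) (t), A ((a, b), s) * B ((b, c), t) * C ((a, c), s * t) := by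
        unfold mergeSum
        refine ENNReal.tsum_le_tsum fun a => ENNReal.tsum_le_tsum fun b =>
          ENNReal.tsum_le_tsum fun c => ENNReal.tsum_le_tsum fun s => ENNReal.tsum_le_tsum fun t => ?_
        by_cases h0 : X (a ++ ι s :: b) = 0
        · simp [h0]
        have hlen := hX _ h0
        rw [List.length_append, List.length_cons] at hlen
        -- The merging letter occupies one place, which leaves only `D` positions for it.
        simp only [A, B, C, if_pos (show a.length < D by omega),
          if_pos (show b.length < D by omega)]
        exact le_rfl
    _ ≤ ∑' (a) (b) (c), f D * (l2norm (fun s => A ((a, b), s)) * l2norm (fun t => B ((b, c), t))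
        * l2norm (fun r => C ((a, c), r))) := by
        gcongr with a b c
        refine (hA a b c).trans (le_of_eq ?_)
        ring
    _ = f D * ∑' (a) (b) (c), l2norm (fun s => A ((a, b), s)) * l2norm (fun t => B ((b, c), t))
        * l2norm (fun r => C ((a, c), r)) := by
        simp_rw [ENNReal.tsum_mul_left]
    _ ≤ f D * (l2norm A * l2norm B * l2norm C) := by
        gcongr
        -- The triangle estimate is applied to norms over the letter variable; `l2norm_fiber`
        -- restores the full norms.
        refine (tsum_triangle_le (fun p => l2norm fun s => A (p, s))
          (fun p => l2norm fun s => B (p, s)) (fun p => l2norm fun s => C (p, s))).trans ?_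
        rw [l2norm_fiber, l2norm_fiber, l2norm_fiber]
    _ ≤ _ := by
        refine mul_le_mul' le_rfl ?_
        refine (mul_le_mul' (mul_le_mul' (l2norm_ite_le _ _ _ hinj X)
          (l2norm_ite_le _ _ _ hinj' Y)) (l2norm_ite_le _ _ _ hinj Z)).trans (le_of_eq ?_)
        ring

end Words
-- The decay function and the modified length
theorem HasSD.isSubexp_mul_max {G H : Type*} [Group G] [Group H] {lG : G → ℝ≥0} {lH : H → ℝ≥0}
    {fG fH : ℕ → ℝ≥0} (hG : HasSD lG fG) (hH : HasSD lH fH) :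
    IsSubexp (fun x : ℕ => (2 * (x : ℝ≥0) + 1) ^ (7 / 2 : ℝ) * max (fG x) (fH x)) := by
  have h1 : Filter.Tendsto (fun n : ℕ => ((2 * (n : ℝ≥0) + 1) ^ (7 / 2 : ℝ)) ^ (1 / (n : ℝ)))
      Filter.atTop (nhds 1) := by
    rw [← NNReal.tendsto_coe]
    have hlim : Filter.Tendsto (fun n : ℕ => (2 * (n : ℝ) + 1)) Filter.atTop Filter.atTop :=
      Filter.tendsto_atTop_add_const_right _ _
        (tendsto_natCast_atTop_atTop.const_mul_atTop (by norm_num))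
    -- With `m = 2n + 1` the exponent `7/(2n)` is `7/(m - 1)`.
    refine ((tendsto_rpow_div_mul_add 7 1 (-1) (by norm_num)).comp hlim).congr fun n => ?_
    push_cast
    rw [← Real.rpow_mul (by positivity)]
    rcases n.eq_zero_or_pos with rfl | hn
    · simp
    · simp only [Function.comp_apply]
      congr 1
      have : (n : ℝ) ≠ 0 := by positivity
      field_simp
      ring
  have h2 := h1.mul (hG.isSubexp.max hH.isSubexp)
  rw [max_self, mul_one] at h2
  refine h2.congr fun n => ?_
  rw [NNReal.mul_rpow]
  congr 1
  exact ((NNReal.monotone_rpow_of_nonneg (by positivity)).map_max).symm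

/-- Raising a length function to be at least `1` off the identity preserves decay. -/
theorem HasSD.exists_one_le_length {G : Type*} [Group G] {l : G → ℝ≥0} {f : ℕ → ℝ≥0}
    (h : HasSD l f) : ∃ l' : G → ℝ≥0, HasSD l' f ∧ ∀ g, g ≠ 1 → 1 ≤ l' g := by
  classical
  refine ⟨fun g => if g = 1 then 0 else max (l g) 1, ⟨h.countable, ⟨by simp, fun g => ?_,
    fun g k => ?_⟩, h.isSubexp, fun D x hx => h.decay D x fun g hg => ?_⟩, fun g hg => by simp [hg]⟩
  · simp [h.isLength.map_inv]
  · by_cases hg : g = 1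
    · simp [hg]
    by_cases hk : k = 1
    · simp [hk]
    by_cases hgk : g * k = 1
    · simp [hgk]
    simp only [hg, hk, hgk, if_false]
    refine max_le ((h.isLength.map_mul_le g k).trans ?_) ?_
    · gcongr <;> exact le_max_left _ _
    · exact le_add_right (le_max_right _ _)
  -- The new length dominates `l`, so its balls are contained in those of `l` and the same `f`
  -- works.
  · by_cases h1 : g = 1
    · simp [h1, h.isLength.map_one]
    · have := hx g hg
      simp only [h1, if_false] at this
      exact (le_max_left _ _).trans this

/-! ### Assembling the estimate on the free product -/

section FreeProduct

variable {G H : Type*} [Group G] [Group H]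

theorem IsReduced.length_le_sum {lG : G → ℝ≥0} {lH : H → ℝ≥0} (hG : ∀ g : G, g ≠ 1 → 1 ≤ lG g)
    (hH : ∀ h : H, h ≠ 1 → 1 ≤ lH h) {w : List (G ⊕ H)} (hw : IsReduced w) :
    (w.length : ℝ≥0) ≤ (w.map (Sum.elim lG lH)).sum := by
  rw [← nsmul_one, ← List.length_map (Sum.elim lG lH)]
  refine List.card_nsmul_le_sum _ _ fun r hr => ?_
  obtain ⟨s, hs, rfl⟩ := List.mem_map.1 hr
  have := hw.1 s hs
  rcases s with s | s
  · exact hG s (by simpa using this)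
  · exact hH s (by simpa using this)

/-- The numerical factor collected from the three kinds of cancellation. -/
theorem split_const_le (D : ℕ) {p q : ℝ≥0} (hp : 1 ≤ p) :
    (((D + 1 : ℕ) : ℝ≥0) ^ (1 / 2 : ℝ)) ^ 3 + (p * ((D : ℝ≥0) ^ (1 / 2 : ℝ)) ^ 3
      + q * ((D : ℝ≥0) ^ (1 / 2 : ℝ)) ^ 3) ≤ (2 * (D : ℝ≥0) + 1) ^ (7 / 2 : ℝ) * max p q := by
  set r := (2 * (D : ℝ≥0) + 1) ^ (1 / 2 : ℝ) with hr
  have hr7 : (2 * (D : ℝ≥0) + 1) ^ (7 / 2 : ℝ) = r ^ 7 := by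
    rw [hr, ← NNReal.rpow_natCast, ← NNReal.rpow_mul]; norm_num
  have hr2 : r ^ 2 = 2 * (D : ℝ≥0) + 1 := by
    rw [hr, ← NNReal.rpow_natCast, ← NNReal.rpow_mul]; norm_num
  have hm : 1 ≤ max p q := hp.trans (le_max_left _ _)
  -- For `D = 0` the merging terms vanish and the first term is `1`, so `1 ≤ p` suffices.
  rcases D.eq_zero_or_pos with rfl | hD
  · simp at hm ⊢
    exact hm
  have h1 : ((D + 1 : ℕ) : ℝ≥0) ^ (1 / 2 : ℝ) ≤ r := by
    rw [hr]
    gcongr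
    push_cast
    gcongr
    exact le_mul_of_one_le_left' (by norm_num)
  have h2 : (D : ℝ≥0) ^ (1 / 2 : ℝ) ≤ r := by
    refine le_trans ?_ h1
    gcongr
    simp
  -- For `D ≥ 1` the three summands give `3 r³ max p q`, and `3 ≤ 2D + 1 = r²` absorbs the `3`. Thus
  -- `r⁵` would already do; the exponent `7` leaves room.
  have h3 : (3 : ℝ≥0) ≤ r ^ 2 := by
    rw [hr2]
    have : (1 : ℝ≥0) ≤ D := by exact_mod_cast hD
    calc (3 : ℝ≥0) = 2 * 1 + 1 := by norm_num
      _ ≤ _ := by gcongr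
  have h4 : (3 : ℝ≥0) ≤ r ^ 4 := by
    calc (3 : ℝ≥0) ≤ 3 * 3 := by norm_num
      _ ≤ r ^ 2 * r ^ 2 := by gcongr
      _ = r ^ 4 := by ring
  calc _ ≤ r ^ 3 * max p q + (max p q * r ^ 3 + max p q * r ^ 3) := by
        gcongr
        · calc _ ≤ r ^ 3 := by gcongr
            _ ≤ _ := le_mul_of_one_le_right' hm
        · exact le_max_left _ _
        · exact le_max_right _ _
    _ = 3 * (r ^ 3 * max p q) := by ring
    _ ≤ r ^ 4 * (r ^ 3 * max p q) := by gcongr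
    _ = _ := by rw [hr7]; ring

theorem HasSD.freeProduct {lG : G → ℝ≥0} {lH : H → ℝ≥0} {fG fH : ℕ → ℝ≥0} (hG : HasSD lG fG)
    (hH : HasSD lH fH) (hG1 : ∀ g : G, g ≠ 1 → 1 ≤ lG g) (hH1 : ∀ h : H, h ≠ 1 → 1 ≤ lH h) :
    HasSD (freeProductLength lG lH)
      (fun x : ℕ => (2 * (x : ℝ≥0) + 1) ^ (7 / 2 : ℝ) * max (fG x) (fH x)) := by
  have := hG.countable
  have := hH.countable
  refine ⟨countable_coprod, isLength_freeProductLength hG.isLength hH.isLength,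
    hG.isSubexp_mul_max hH, fun D x hx => opNorm_le_of_trilinear x _ fun Y Z hY => ?_⟩
  set X : Monoid.Coprod G H → ℝ≥0∞ := fun g => ‖x.coeff g‖ₑ with hXdef
  have hsum : ∀ w, onWords X w ≠ 0 → IsReduced w ∧ (w.map (Sum.elim lG lH)).sum ≤ D := by
    intro w hw
    have hr := isReduced_of_onWords_ne_zero hw
    refine ⟨hr, ?_⟩
    rw [← freeProductLength_wordProd lG lH hr]
    refine hx _ ?_
    rw [onWords_of_isReduced _ hr] at hw
    simpa [hXdef] using hw
  -- This is where lengths at least `1` off the identity enter: they turn the length bound into a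
  -- bound on the number of letters.
  have hlen : ∀ w, onWords X w ≠ 0 → w.length ≤ D := fun w hw => by
    exact_mod_cast ((hsum w hw).1.length_le_sum hG1 hH1).trans (hsum w hw).2
  have hmem : ∀ a s b, onWords X (a ++ s :: b) ≠ 0 → Sum.elim lG lH s ≤ D := fun a s b h =>
    (List.single_le_sum (fun _ _ => zero_le) _ (List.mem_map_of_mem (by simp))).trans (hsum _ h).2
  have hfin : (Function.support (onWords X)).Finite :=
    finite_support_onWords (x.coeff.support.finite_toSet.subset fun g hg => by
      simpa [hXdef] using hg)
  have htop : ∀ w, onWords X w ≠ ∞ := fun w => by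
    unfold onWords
    split_ifs
    exacts [enorm_ne_top, ENNReal.zero_ne_top]
  have hY' : l2norm (onWords Y) ≠ ∞ := ne_top_of_le_ne_top hY (l2norm_onWords_le Y)
  have hc := split_const_le D (q := fH D) (hG.one_le D)
  calc ∑' (s) (t), X s * Y t * Z (s * t)
      ≤ _ := tsum_le_words X Y Z
    _ ≤ (((D + 1 : ℕ) : ℝ≥0∞) ^ (1 / 2 : ℝ)) ^ 3
          * (l2norm (onWords X) * l2norm (onWords Y) * l2norm (onWords Z))
        + (fG D * (((D : ℝ≥0∞) ^ (1 / 2 : ℝ)) ^ 3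
          * (l2norm (onWords X) * l2norm (onWords Y) * l2norm (onWords Z)))
        + fH D * (((D : ℝ≥0∞) ^ (1 / 2 : ℝ)) ^ 3
          * (l2norm (onWords X) * l2norm (onWords Y) * l2norm (onWords Z)))) := by
        refine add_le_add (cancelSum_le D _ _ _ hlen) (add_le_add ?_ ?_)
        · exact mergeSum_le hG Sum.inl_injective D _ _ _ hfin htop hlen
            (fun a s b h => hmem a _ b h) hY'
        · exact mergeSum_le hH Sum.inr_injective D _ _ _ hfin htop hlen
            (fun a s b h => hmem a _ b h) hY'
    _ = ((((D + 1 : ℕ) : ℝ≥0∞) ^ (1 / 2 : ℝ)) ^ 3 + (fG D * ((D : ℝ≥0∞) ^ (1 / 2 : ℝ)) ^ 3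
          + fH D * ((D : ℝ≥0∞) ^ (1 / 2 : ℝ)) ^ 3))
          * (l2norm (onWords X) * l2norm (onWords Y) * l2norm (onWords Z)) := by ring
    _ ≤ ((2 * (D : ℝ≥0) + 1) ^ (7 / 2 : ℝ) * max (fG D) (fH D) : ℝ≥0)
          * (l2norm X * l2norm Y * l2norm Z) := by
        have hc' := ENNReal.coe_le_coe.2 hc
        simp only [ENNReal.coe_add, ENNReal.coe_mul, ENNReal.coe_pow,
          ENNReal.coe_rpow_of_nonneg _ (show (0 : ℝ) ≤ 1 / 2 by norm_num),
          ENNReal.coe_natCast] at hc'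
        rw [ENNReal.coe_mul]
        exact mul_le_mul' hc' (mul_le_mul' (mul_le_mul' (l2norm_onWords_le X)
          (l2norm_onWords_le Y)) (l2norm_onWords_le Z))
    _ = _ := by ring

end FreeProduct
end SubexpDecay

theorem mainTheorem9 {G H : Type*} [Group G] [Group H]
    (lG : G → ℝ≥0) (lH : H → ℝ≥0) (fG fH : ℕ → ℝ≥0)
    (hG : SubexpDecay.HasSD lG fG) (hH : SubexpDecay.HasSD lH fH) :
    (∃ l : Monoid.Coprod G H → ℝ≥0,
      SubexpDecay.HasSD l
        (fun x : ℕ => (2 * (x : ℝ≥0) + 1) ^ (7 / 2 : ℝ) * max (fG x) (fH x))) ∧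
    ((∀ g : G, g ≠ 1 → 1 ≤ lG g) → (∀ h : H, h ≠ 1 → 1 ≤ lH h) →
      SubexpDecay.HasSD (SubexpDecay.freeProductLength lG lH)
        (fun x : ℕ => (2 * (x : ℝ≥0) + 1) ^ (7 / 2 : ℝ) * max (fG x) (fH x))) := by
  refine ⟨?_, hG.freeProduct hH⟩
  obtain ⟨lG', hG', hG1⟩ := hG.exists_one_le_length
  obtain ⟨lH', hH', hH1⟩ := hH.exists_one_le_length
  exact ⟨_, hG'.freeProduct hH' hG1 hH1⟩
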